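/- Let $\Xi$ be the Riemann Xi function, i.e. the entire function obtained from $$\Xi(z)=-\frac{1+4z^{2}}{8\,\pi^{(1+2iz)/4}}\,\Gamma\!\left(\frac{1+2iz}{4}\right)\zeta\!\left(\frac{1+2iz}{2}\right)$$ by filling in the removable singularities of the right-hand side (equivalently $\Xi(z)=\xi(\tfrac12+iz)$ with $\xi(s)=\tfrac12 s(s-1)\pi^{-s/2}\Gamma(s/2)\zeta(s)$). (a) There is a function $\phi:\mathbb{R}\to(0,\infty)$ such that for every $z\in\mathbb{C}$ the function $t\mapsto e^{-itz}\phi(t)$ is Lebesgue integrable on $\mathbb{R}$ and $$\Xi(z)=\int_{-\infty}^{\infty}e^{-itz}\phi(t)\,dt .$$ (b) For all $n,m\in\mathbb{N}$ and all complex numbers $z_{j,\ell}$ ($1\le j\le n$, $1\le\ell\le m$), the matrix $$\left(\prod_{\ell=1}^{m}\Xi\left(z_{j,\ell}-\overline{z_{k,\ell}}\right)\right)_{j,k=1}^{n}$$ is positive semidefinite, i.e. $\sum_{j,k=1}^{n}c_{j}\overline{c_{k}}\prod_{\ell=1}^{m}\Xi(z_{j,\ell}-\overline{z_{k,\ell}})\ge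 0$ for all $c_1,\dots,c_n\in\mathbb{C}$. -/

import Mathlib

open Filter Topology
open scoped ComplexOrder

/-- The expression `-(1 + 4 z²) / (8 π^((1 + 2 i z)/4)) · Γ((1 + 2 i z)/4) · ζ((1 + 2 i z)/2)`.
It is holomorphic away from the isolated points where `(1 + 2 i z)/2` is `1` or a pole
`0, -2, -4, …` of `s ↦ Γ(s/2)`; at those points the Lean term has a meaningless value. -/
noncomputable def riemannXiExpr (z : ℂ) : ℂ :=
  -(1 + 4 * z ^ 2) / (8 * (Real.pi : ℂ) ^ ((1 + 2 * Complex.I * z) / 4)) *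
    Complex.Gamma ((1 + 2 * Complex.I * z) / 4) * riemannZeta ((1 + 2 * Complex.I * z) / 2)

/-- The Riemann Xi function: the entire function obtained from `riemannXiExpr` by filling in its
removable singularities, i.e. its value at `z` is the limit of `riemannXiExpr w` as `w → z`,
`w ≠ z`. -/
noncomputable def riemannXi (z : ℂ) : ℂ :=
  limUnder (𝓝[≠] z) riemannXiExpr

/-- Away from its singularities the defining expression is `(s (s - 1) Λ₀(s) + 1) / 2` with
`s = 1/2 + i z`, where `Λ₀` is the (entire) completed zeta function with its poles removed. -/
theorem riemannXiExpr_eq {z : ℂ} (h1 : (1 + 2 * Complex.I * z) / 2 ≠ 1)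
    (hG : (Complex.Gamma ((1 + 2 * Complex.I * z) / 4))⁻¹ ≠ 0) :
    riemannXiExpr z = ((1 + 2 * Complex.I * z) / 2 * ((1 + 2 * Complex.I * z) / 2 - 1) *
      completedRiemannZeta₀ ((1 + 2 * Complex.I * z) / 2) + 1) / 2 := by
  have hG' : Complex.Gamma ((1 + 2 * Complex.I * z) / 4) ≠ 0 := by
    intro h; exact hG (by rw [h, inv_zero])
  have h0 : (1 + 2 * Complex.I * z) / 2 ≠ 0 := by
    intro h
    apply hG'
    have : (1 + 2 * Complex.I * z) / 4 = 0 := by linear_combination h / 2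
    rw [this, Complex.Gamma_zero]
  have hz : -(1 + 4 * z ^ 2) =
      4 * ((1 + 2 * Complex.I * z) / 2 * ((1 + 2 * Complex.I * z) / 2 - 1)) := by
    linear_combination (-4 * z ^ 2) * Complex.I_sq
  have h4 : (1 + 2 * Complex.I * z) / 4 = (1 + 2 * Complex.I * z) / 2 / 2 := by ring
  have hpi : (Real.pi : ℂ) ≠ 0 := by exact_mod_cast Real.pi_ne_zero
  rw [riemannXiExpr, riemannZeta_eq_completedRiemannZeta₀ h0, hz]
  rw [h4] at hG' ⊢
  generalize (1 + 2 * Complex.I * z) / 2 = s at *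
  have hs : 1 - s ≠ 0 := sub_ne_zero.mpr (Ne.symm h1)
  have hp : (Real.pi : ℂ) ^ (s / 2) ≠ 0 := by simp [Complex.cpow_eq_zero_iff, hpi]
  have hn : (Real.pi : ℂ) ^ (-s / 2) = ((Real.pi : ℂ) ^ (s / 2))⁻¹ := by
    rw [neg_div, Complex.cpow_neg]
  rw [hn]
  field_simp
  ring

/-- The limits in the definition of `riemannXi` exist, and `riemannXi` is the entire function
`(s (s - 1) Λ₀(s) + 1) / 2`, `s = 1/2 + i z`. -/
theorem riemannXi_eq (z : ℂ) :
    Tendsto riemannXiExpr (𝓝[≠] z) (𝓝 (riemannXi z)) ∧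
    riemannXi z = ((1 + 2 * Complex.I * z) / 2 * ((1 + 2 * Complex.I * z) / 2 - 1) *
      completedRiemannZeta₀ ((1 + 2 * Complex.I * z) / 2) + 1) / 2 := by
  have hd : Differentiable ℂ fun w : ℂ => (Complex.Gamma ((1 + 2 * Complex.I * w) / 4))⁻¹ :=
    Complex.differentiable_one_div_Gamma.comp
      (g := fun s : ℂ => (Complex.Gamma s)⁻¹) (f := fun w : ℂ => (1 + 2 * Complex.I * w) / 4)
      (by fun_prop)
  have han : AnalyticOnNhd ℂ (fun w : ℂ => (Complex.Gamma ((1 + 2 * Complex.I * w) / 4))⁻¹)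
      Set.univ := fun w _ => hd.analyticAt w
  have hne : ∀ᶠ w in 𝓝[≠] z, (Complex.Gamma ((1 + 2 * Complex.I * w) / 4))⁻¹ ≠ 0 := by
    rcases (han z trivial).eventually_eq_zero_or_eventually_ne_zero with h | h
    · exfalso
      have h' := han.eqOn_zero_of_preconnected_of_eventuallyEq_zero isPreconnected_univ
        (Set.mem_univ z) h (Set.mem_univ (0 : ℂ))
      have : Complex.Gamma ((1 + 2 * Complex.I * 0) / 4) ≠ 0 :=
        Complex.Gamma_ne_zero_of_re_pos (by norm_num)
      exact inv_ne_zero this h'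
    · exact h
  have hone : ∀ᶠ w in 𝓝[≠] z, (1 + 2 * Complex.I * w) / 2 ≠ 1 := by
    have hfin : ∀ᶠ w in 𝓝[≠] z, w ≠ -Complex.I / 2 := by
      by_cases hz : z = -Complex.I / 2
      · subst hz; exact eventually_mem_nhdsWithin
      · exact nhdsWithin_le_nhds (isOpen_ne.mem_nhds hz)
    filter_upwards [hfin] with w hw h
    apply hw
    linear_combination (-Complex.I) * h + w * Complex.I_sq
  have hcont : Continuous fun w : ℂ => ((1 + 2 * Complex.I * w) / 2 *
      ((1 + 2 * Complex.I * w) / 2 - 1) *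
      completedRiemannZeta₀ ((1 + 2 * Complex.I * w) / 2) + 1) / 2 := by
    have := differentiable_completedZeta₀.continuous
    fun_prop
  have ht : Tendsto riemannXiExpr (𝓝[≠] z) (𝓝 (((1 + 2 * Complex.I * z) / 2 *
      ((1 + 2 * Complex.I * z) / 2 - 1) *
      completedRiemannZeta₀ ((1 + 2 * Complex.I * z) / 2) + 1) / 2)) := by
    refine Tendsto.congr' ?_ ((hcont.tendsto z).mono_left nhdsWithin_le_nhds)
    filter_upwards [hne, hone] with w h h1
    exact (riemannXiExpr_eq h1 h).symm
  have he := ht.limUnder_eq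
  exact ⟨by rw [riemannXi, he]; exact ht, he⟩

/-! Let `ψ(x) = ∑ exp(-π n² x)`, `n ≥ 1`. The Mellin transform of `ψ` at `w` is `Λ(2w)` (`Λ` the
completed zeta function), and `x ψ'`, `x² ψ''` contribute the factors `-w`, `w (w + 1)`. Hence `K =
2 x² ψ'' + 3 x ψ'` has transform `w (2w - 1) Λ(2w) = ξ(2w)`. The operator `2 x² D² + 3 x D`
annihilates `1` and `x^(-1/2)`, the two terms that spoil the symmetry of `ψ`, so `K(1/x) = x^(1/2)
K(x)` (`xiKernel_inv`). This symmetry carries two properties of `K` from infinity to zero: rapid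
decay, so the transform is entire and the identity extends to the whole plane (`mellin_xiKernel`),
and positivity, visible termwise for `x ≥ 1` (`xiKernel_pos`). Substituting `x = e^(-2t)` gives the
Fourier integral (`riemannXi_fourier`).

For (b), `e^(-it(z_j - conj z_k))` is a rank-one positive kernel in `j, k` for each `t`; integrating
against a positive density preserves positivity (`posSemidef_of_fourier`), and Schur's product
theorem handles products (`posSemidef_prod`). -/

section XiKernel

open Set MeasureTheory Asymptotics

/-! ### Theta series: convergence, derivatives, growth at zero and infinity. -/

/-- The exponents `π (n + 1)²` of the theta series. -/
noncomputable def thetaExponent (n : ℕ) : ℝ := Real.pi * ((n : ℝ) + 1) ^ 2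

/-- The `k`-th derivative `∑ (-π n²)ᵏ exp (-π n² x)`, `n ≥ 1`, of the theta series
`∑ exp (-π n² x)`. -/
noncomputable def thetaTail (k : ℕ) (x : ℝ) : ℝ :=
  ∑' n : ℕ, (-thetaExponent n) ^ k * Real.exp (-thetaExponent n * x)

lemma pi_le_thetaExponent (n : ℕ) : Real.pi ≤ thetaExponent n := by
  unfold thetaExponent
  have h : (1 : ℝ) ≤ ((n : ℝ) + 1) ^ 2 := one_le_pow₀ (by linarith [n.cast_nonneg (α := ℝ)])
  nlinarith [Real.pi_pos]

lemma thetaExponent_pos (n : ℕ) : 0 < thetaExponent n :=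
  Real.pi_pos.trans_le (pi_le_thetaExponent n)

lemma summable_inv_thetaExponent : Summable fun n => (thetaExponent n)⁻¹ := by
  have h : Summable fun n : ℕ => ((n : ℝ) ^ 2)⁻¹ :=
    Real.summable_nat_pow_inv.mpr one_lt_two
  have h' := ((summable_nat_add_iff 1).mpr h).mul_left Real.pi⁻¹
  refine h'.congr fun n => ?_
  simp [thetaExponent, mul_comm]

lemma norm_thetaTail_term (k n : ℕ) (x : ℝ) :
    ‖(-thetaExponent n) ^ k * Real.exp (-thetaExponent n * x)‖ =
      thetaExponent n ^ k * Real.exp (-thetaExponent n * x) := by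
  rw [norm_mul, norm_pow, norm_neg, Real.norm_of_nonneg (thetaExponent_pos n).le,
    Real.norm_of_nonneg (Real.exp_pos _).le]

lemma thetaTail_term_le (k n : ℕ) {x : ℝ} (hx : 0 < x) :
    thetaExponent n ^ k * Real.exp (-thetaExponent n * x) ≤
      ((k + 1).factorial / x ^ (k + 1)) * (thetaExponent n)⁻¹ := by
  have hp := thetaExponent_pos n
  -- Bounding `exp` below by its term of degree `k + 1`, not `k`, leaves a spare factor
  -- `(thetaExponent n)⁻¹`, which is summable.
  have h := Real.pow_div_factorial_le_exp (thetaExponent n * x) (by positivity) (k + 1)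
  rw [div_le_iff₀ (by positivity), mul_pow] at h
  rw [neg_mul, Real.exp_neg, ← div_eq_mul_inv, ← div_eq_mul_inv, div_div,
    div_le_div_iff₀ (Real.exp_pos _) (by positivity)]
  calc thetaExponent n ^ k * (x ^ (k + 1) * thetaExponent n)
      = thetaExponent n ^ (k + 1) * x ^ (k + 1) := by ring
    _ ≤ _ := by linarith

lemma summable_thetaExponent_pow_mul_exp (k : ℕ) {x : ℝ} (hx : 0 < x) :
    Summable fun n => thetaExponent n ^ k * Real.exp (-thetaExponent n * x) :=
  .of_nonneg_of_le (fun n => by have := thetaExponent_pos n; positivity)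
    (fun n => thetaTail_term_le k n hx) (summable_inv_thetaExponent.mul_left _)

lemma summable_thetaTail (k : ℕ) {x : ℝ} (hx : 0 < x) :
    Summable fun n => (-thetaExponent n) ^ k * Real.exp (-thetaExponent n * x) :=
  .of_norm ((summable_thetaExponent_pow_mul_exp k hx).congr
    fun n => (norm_thetaTail_term k n x).symm)

lemma norm_thetaTail_le (k : ℕ) {x : ℝ} (hx : 0 < x) :
    ‖thetaTail k x‖ ≤ ∑' n, thetaExponent n ^ k * Real.exp (-thetaExponent n * x) :=
  tsum_of_norm_bounded (summable_thetaExponent_pow_mul_exp k hx).hasSum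
    fun n => (norm_thetaTail_term k n x).le

lemma hasDerivAt_thetaTail (k : ℕ) {x : ℝ} (hx : 0 < x) :
    HasDerivAt (thetaTail k) (thetaTail (k + 1) x) x := by
  -- Termwise differentiation needs a uniform bound on the derivatives; on `(x/2, ∞)` their values
  -- at `x/2` provide one.
  have hx2 : 0 < x / 2 := by positivity
  refine hasDerivAt_tsum_of_isPreconnected (t := Ioi (x / 2)) (y₀ := x)
    (g := fun n y => (-thetaExponent n) ^ k * Real.exp (-thetaExponent n * y))
    (g' := fun n y => (-thetaExponent n) ^ (k + 1) * Real.exp (-thetaExponent n * y))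
    (summable_thetaExponent_pow_mul_exp (k + 1) hx2) isOpen_Ioi isPreconnected_Ioi
    (fun n y _ => ?_) (fun n y hy => ?_) (half_lt_self hx) (summable_thetaTail k hx)
    (half_lt_self hx)
  · have h := (((hasDerivAt_id y).const_mul (-thetaExponent n)).exp).const_mul
      ((-thetaExponent n) ^ k)
    exact h.congr_deriv (by simp only [id, mul_one]; ring)
  · rw [norm_thetaTail_term]
    have := thetaExponent_pos n
    have hy' : x / 2 < y := hy
    refine mul_le_mul_of_nonneg_left (Real.exp_le_exp.mpr ?_) (by positivity)
    nlinarith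

lemma continuousOn_thetaTail (k : ℕ) : ContinuousOn (thetaTail k) (Ioi 0) :=
  fun _ hx => (hasDerivAt_thetaTail k hx).continuousAt.continuousWithinAt

lemma thetaTail_isBigO_zero (k : ℕ) :
    thetaTail k =O[𝓝[>] 0] fun x : ℝ => x ^ (-((k : ℝ) + 1)) := by
  refine .of_bound ((k + 1).factorial * ∑' n, (thetaExponent n)⁻¹) ?_
  filter_upwards [self_mem_nhdsWithin] with x (hx : 0 < x)
  refine (tsum_of_norm_bounded ((summable_inv_thetaExponent.mul_left _).hasSum)
    fun n => (norm_thetaTail_term k n x).trans_le (thetaTail_term_le k n hx)).trans_eq ?_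
  rw [tsum_mul_left, Real.rpow_neg hx.le, Real.norm_of_nonneg (by positivity)]
  norm_cast
  ring

/-- With `λ = thetaExponent n ≥ π` and `x ≥ 1`, `λ x ≥ λ / 2 + π x / 2`: half of the exponent pays
for summability, the rest for decay. -/
lemma thetaTail_isBigO_exp (k : ℕ) :
    thetaTail k =O[atTop] fun x : ℝ => Real.exp (-(Real.pi / 2) * x) := by
  refine .of_bound (∑' n, thetaExponent n ^ k * Real.exp (-thetaExponent n * (1 / 2))) ?_
  filter_upwards [eventually_ge_atTop 1] with x hx
  rw [Real.norm_of_nonneg (Real.exp_pos _).le, ← tsum_mul_right]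
  refine (norm_thetaTail_le k (by linarith)).trans
    ((summable_thetaExponent_pow_mul_exp k (by linarith)).tsum_le_tsum (fun n => ?_)
      ((summable_thetaExponent_pow_mul_exp k (by norm_num)).mul_right _))
  have hp := thetaExponent_pos n
  rw [mul_assoc, ← Real.exp_add]
  gcongr
  nlinarith [pi_le_thetaExponent n]

/-! ### Functional equation of the theta function and of its first two derivatives. -/

lemma one_add_two_mul_thetaTail {x : ℝ} (hx : 0 < x) :
    1 + 2 * thetaTail 0 x = HurwitzZeta.cosKernel 0 x := by
  have h := (HurwitzZeta.hasSum_nat_cosKernel₀ 0 hx).tsum_eq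
  simp only [mul_zero, zero_mul, Real.cos_zero, mul_one, QuotientAddGroup.mk_zero] at h
  rw [tsum_mul_left] at h
  simp only [thetaTail, thetaExponent, pow_zero, one_mul, ← neg_mul]
  linarith

/-- The functional equation of the theta function. -/
lemma thetaTail_zero_eq {x : ℝ} (hx : 0 < x) :
    1 + 2 * thetaTail 0 x = x ^ (-(1 / 2) : ℝ) * (1 + 2 * thetaTail 0 x⁻¹) := by
  rw [one_add_two_mul_thetaTail hx, one_add_two_mul_thetaTail (inv_pos.mpr hx),
    ← HurwitzZeta.evenKernel_eq_cosKernel_of_zero, HurwitzZeta.evenKernel_functional_equation,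
    HurwitzZeta.evenKernel_eq_cosKernel_of_zero, Real.rpow_neg hx.le, one_div, one_div x]

lemma hasDerivAt_thetaTail_inv (k : ℕ) {x : ℝ} (hx : 0 < x) :
    HasDerivAt (fun y => thetaTail k y⁻¹) (thetaTail (k + 1) x⁻¹ * (-(x ^ 2)⁻¹)) x :=
  (hasDerivAt_thetaTail k (inv_pos.mpr hx)).comp x (hasDerivAt_inv hx.ne')

/-- Both sides of `thetaTail_zero_eq` agree near `x`, so their derivatives agree; `thetaTail_two_eq`
repeats the argument. -/
lemma thetaTail_one_eq {x : ℝ} (hx : 0 < x) :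
    2 * thetaTail 1 x = -(1 / 2) * x ^ (-(3 / 2) : ℝ) * (1 + 2 * thetaTail 0 x⁻¹) -
      2 * x ^ (-(5 / 2) : ℝ) * thetaTail 1 x⁻¹ := by
  have h1 := ((hasDerivAt_thetaTail 0 hx).const_mul 2).const_add 1
  have h2 := (Real.hasDerivAt_rpow_const (p := -(1 / 2)) (Or.inl hx.ne')).mul
    (((hasDerivAt_thetaTail_inv 0 hx).const_mul 2).const_add 1)
  have h := h1.unique (h2.congr_of_eventuallyEq
    ((eventually_gt_nhds hx).mono fun y hy => thetaTail_zero_eq hy))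
  have e : x ^ (-(1 / 2) : ℝ) * (x ^ 2)⁻¹ = x ^ (-(5 / 2) : ℝ) := by
    rw [← Real.rpow_natCast x 2, ← Real.rpow_neg hx.le, ← Real.rpow_add hx]; norm_num
  rw [← e]
  norm_num at h ⊢
  linear_combination h

lemma thetaTail_two_eq {x : ℝ} (hx : 0 < x) :
    2 * thetaTail 2 x = 3 / 4 * x ^ (-(5 / 2) : ℝ) * (1 + 2 * thetaTail 0 x⁻¹) +
      6 * x ^ (-(7 / 2) : ℝ) * thetaTail 1 x⁻¹ + 2 * x ^ (-(9 / 2) : ℝ) * thetaTail 2 x⁻¹ := by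
  have h1 := (hasDerivAt_thetaTail 1 hx).const_mul 2
  have h2 := (((Real.hasDerivAt_rpow_const (p := -(3 / 2)) (Or.inl hx.ne')).const_mul
      (-(1 / 2))).mul (((hasDerivAt_thetaTail_inv 0 hx).const_mul 2).const_add 1)).sub
    (((Real.hasDerivAt_rpow_const (p := -(5 / 2)) (Or.inl hx.ne')).const_mul 2).mul
      (hasDerivAt_thetaTail_inv 1 hx))
  have h := h1.unique (h2.congr_of_eventuallyEq
    ((eventually_gt_nhds hx).mono fun y hy => thetaTail_one_eq hy))
  have e1 : x ^ (-(3 / 2) : ℝ) * (x ^ 2)⁻¹ = x ^ (-(7 / 2) : ℝ) := by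
    rw [← Real.rpow_natCast x 2, ← Real.rpow_neg hx.le, ← Real.rpow_add hx]; norm_num
  have e2 : x ^ (-(5 / 2) : ℝ) * (x ^ 2)⁻¹ = x ^ (-(9 / 2) : ℝ) := by
    rw [← Real.rpow_natCast x 2, ← Real.rpow_neg hx.le, ← Real.rpow_add hx]; norm_num
  norm_num at h e1 e2 ⊢
  linear_combination h + thetaTail 1 x⁻¹ * e1 + 2 * thetaTail 2 x⁻¹ * e2

/-! ### The kernel: symmetry, positivity, decay. -/

/-- The function `∑ (2 π² n⁴ x² - 3 π n² x) exp (-π n² x)`, `n ≥ 1`, whose Mellin transform at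
`s / 2` is Riemann's `ξ(s)`. -/
noncomputable def xiKernel (x : ℝ) : ℝ := 2 * x ^ 2 * thetaTail 2 x + 3 * x * thetaTail 1 x

lemma continuousOn_xiKernel : ContinuousOn xiKernel (Ioi 0) := by
  have h1 := continuousOn_thetaTail 1
  have h2 := continuousOn_thetaTail 2
  unfold xiKernel
  fun_prop

lemma xiKernel_inv {x : ℝ} (hx : 0 < x) : xiKernel x⁻¹ = x ^ (1 / 2 : ℝ) * xiKernel x := by
  have h1 := thetaTail_one_eq hx
  have h2 := thetaTail_two_eq hx
  obtain ⟨y, hy, rfl⟩ : ∃ y : ℝ, 0 < y ∧ x = y ^ 2 :=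
    -- With `x = y²` all half-integer powers become integer powers of `y`, and the claim is rational
    -- algebra.
    ⟨√x, Real.sqrt_pos.mpr hx, (Real.sq_sqrt hx.le).symm⟩
  have e (n : ℕ) (a : ℝ) (ha : 2 * a = n) : (y ^ 2) ^ (-a) = (y ^ n)⁻¹ := by
    rw [← Real.rpow_natCast y 2, ← Real.rpow_mul hy.le, ← Real.rpow_natCast y n,
      ← Real.rpow_neg hy.le, ← ha]
    norm_num
  have e' : (y ^ 2) ^ (1 / 2 : ℝ) = y := by
    rw [← Real.sqrt_eq_rpow, Real.sqrt_sq hy.le]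
  rw [e 3 _ (by norm_num), e 5 _ (by norm_num)] at h1
  rw [e 5 _ (by norm_num), e 7 _ (by norm_num), e 9 _ (by norm_num)] at h2
  rw [e', xiKernel, xiKernel,
    show y * (2 * (y ^ 2) ^ 2 * thetaTail 2 (y ^ 2) + 3 * y ^ 2 * thetaTail 1 (y ^ 2)) =
      y ^ 5 * (2 * thetaTail 2 (y ^ 2)) + 3 / 2 * y ^ 3 * (2 * thetaTail 1 (y ^ 2)) by ring, h1, h2]
  field_simp
  ring

lemma xiKernel_pos_of_one_le {x : ℝ} (hx : 1 ≤ x) : 0 < xiKernel x := by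
  have hx0 : 0 < x := by linarith
  rw [xiKernel, thetaTail, thetaTail, ← tsum_mul_left, ← tsum_mul_left,
    ← ((summable_thetaTail 2 hx0).mul_left _).tsum_add ((summable_thetaTail 1 hx0).mul_left _)]
  have hpos (n : ℕ) : 0 < 2 * x ^ 2 * ((-thetaExponent n) ^ 2 * Real.exp (-thetaExponent n * x)) +
      3 * x * ((-thetaExponent n) ^ 1 * Real.exp (-thetaExponent n * x)) := by
    -- Each term factors as `u (2u - 3) e^(-u)` with `u = thetaExponent n * x > 3`.
    have hp : 3 < thetaExponent n := Real.pi_gt_three.trans_le (pi_le_thetaExponent n)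
    have h : 0 < 2 * (thetaExponent n * x) - 3 := by nlinarith
    have : 0 < thetaExponent n * x * (2 * (thetaExponent n * x) - 3) *
      Real.exp (-thetaExponent n * x) := by
      have := thetaExponent_pos n
      positivity
    linarith
  exact (((summable_thetaTail 2 hx0).mul_left _).add ((summable_thetaTail 1 hx0).mul_left _)).tsum_pos
    (fun n => (hpos n).le) 0 (hpos 0)

lemma xiKernel_pos {x : ℝ} (hx : 0 < x) : 0 < xiKernel x := by
  rcases le_total 1 x with h | h
  · exact xiKernel_pos_of_one_le h
  · have := xiKernel_pos_of_one_le ((one_le_inv₀ hx).mpr h)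
    rw [xiKernel_inv hx] at this
    exact (mul_pos_iff_of_pos_left (by positivity)).mp this

lemma xiKernel_isBigO_rpow (r : ℝ) : xiKernel =O[atTop] fun x : ℝ => x ^ r := by
  have h (c : ℝ) (j k : ℕ) : (fun x => c * x ^ j * thetaTail k x) =O[atTop] fun x : ℝ => x ^ r := by
    have h1 := (thetaTail_isBigO_exp k).trans
      (isLittleO_exp_neg_mul_rpow_atTop (half_pos Real.pi_pos) (r - j)).isBigO
    refine (((isBigO_refl (fun x : ℝ => x ^ j) atTop).const_mul_left c).mul h1).congr' .rfl ?_
    filter_upwards [eventually_gt_atTop 0] with x hx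
    rw [← Real.rpow_natCast, ← Real.rpow_add hx]
    simp
  refine ((h 2 2 2).add (h 3 1 1)).congr_left fun x => ?_
  rw [xiKernel, pow_one]

end XiKernel

/-! ### Mellin transform of the kernel, and its form as a Fourier integral. -/

section XiMellin

open Set MeasureTheory Asymptotics

/-- `xiKernel` and its functional equation under `x ↦ 1 / x`. -/
noncomputable def xiKernelFEPair : WeakFEPair ℂ where
  f x := xiKernel x
  g x := xiKernel x
  k := 1 / 2
  ε := 1
  -- The kernel has no constant term at infinity, so the pair is strong and its Mellin transform is
  -- entire.
  f₀ := 0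
  g₀ := 0
  hf_int := (Complex.continuous_ofReal.comp_continuousOn
    continuousOn_xiKernel).locallyIntegrableOn measurableSet_Ioi
  hg_int := (Complex.continuous_ofReal.comp_continuousOn
    continuousOn_xiKernel).locallyIntegrableOn measurableSet_Ioi
  hk := by norm_num
  hε := one_ne_zero
  h_feq x hx := by
    rw [one_div x, xiKernel_inv hx]
    simp
  hf_top r := by
    simpa using Complex.isBigO_ofReal_left.mpr (xiKernel_isBigO_rpow r)
  hg_top r := by
    simpa using Complex.isBigO_ofReal_left.mpr (xiKernel_isBigO_rpow r)

lemma isStrongFEPair_xiKernelFEPair : IsStrongFEPair xiKernelFEPair := ⟨rfl, rfl⟩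

lemma mellinConvergent_xiKernel (s : ℂ) : MellinConvergent (fun x => (xiKernel x : ℂ)) s :=
  (isStrongFEPair_xiKernelFEPair.hasMellin s).1

lemma differentiable_mellin_xiKernel :
    Differentiable ℂ (mellin fun x => (xiKernel x : ℂ)) := by
  have h := isStrongFEPair_xiKernelFEPair.differentiable_Λ
  rwa [isStrongFEPair_xiKernelFEPair.Λ_eq] at h

lemma mellinConvergent_thetaTail (k : ℕ) {s : ℂ} (hs : k + 1 < s.re) :
    MellinConvergent (fun x => (thetaTail k x : ℂ)) s :=
  mellinConvergent_of_isBigO_rpow_exp (half_pos Real.pi_pos)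
    ((Complex.continuous_ofReal.comp_continuousOn
      (continuousOn_thetaTail k)).locallyIntegrableOn measurableSet_Ioi)
    (Complex.isBigO_ofReal_left.mpr (thetaTail_isBigO_exp k))
    (Complex.isBigO_ofReal_left.mpr (thetaTail_isBigO_zero k)) hs

/-- At `s + k` the coefficient `thetaExponent n ^ k` cancels, so every `k` gives the same Dirichlet
series, up to sign and Gamma factor. -/
lemma mellin_thetaTail (k : ℕ) {s : ℂ} (hs : 1 < s.re) :
    mellin (fun x => (thetaTail k x : ℂ)) (s + k) =
      (-1) ^ k * Complex.Gamma (s + k) * ∑' n, (thetaExponent n : ℂ) ^ (-s) := by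
  have hc (n : ℕ) : (thetaExponent n : ℂ) ≠ 0 := by
    exact_mod_cast (thetaExponent_pos n).ne'
  have h := hasSum_mellin (a := fun n => (-(thetaExponent n : ℂ)) ^ k) (p := thetaExponent)
    (F := fun x => (thetaTail k x : ℂ)) (s := s + k) (fun n => Or.inr (thetaExponent_pos n))
    (by simp; positivity)
    (fun t ht => by
      have := (summable_thetaTail k ht).hasSum
      exact_mod_cast this)
    (by
      refine .of_nonneg_of_le (fun n => by have := thetaExponent_pos n; positivity) (fun n => ?_)
        summable_inv_thetaExponent
      have hp := thetaExponent_pos n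
      have h1 : 1 ≤ thetaExponent n := by
        linarith [Real.pi_gt_three, pi_le_thetaExponent n]
      rw [norm_pow, norm_neg, Complex.norm_of_nonneg hp.le, ← Real.rpow_natCast,
        ← Real.rpow_sub hp, ← Real.rpow_neg_one]
      refine Real.rpow_le_rpow_of_exponent_le h1 ?_
      simp
      linarith)
  rw [← h.tsum_eq, ← tsum_mul_left]
  refine tsum_congr fun n => ?_
  rw [neg_pow, Complex.cpow_add _ _ (hc n), Complex.cpow_natCast, Complex.cpow_neg]
  have := pow_ne_zero k (hc n)
  have h' : (thetaExponent n : ℂ) ^ s ≠ 0 := by simp [Complex.cpow_eq_zero_iff, hc n]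
  field_simp

lemma tsum_thetaExponent_cpow {s : ℂ} (hs : 1 < s.re) :
    Complex.Gamma s * ∑' n, (thetaExponent n : ℂ) ^ (-s) = completedRiemannZeta (2 * s) := by
  have hs2 : 1 < (2 * s).re := by simp; linarith
  rw [completedZeta_eq_tsum_of_one_lt_re hs2, ← zeta_eq_tsum_one_div_nat_cpow hs2,
    zeta_eq_tsum_one_div_nat_add_one_cpow hs2, show -(2 * s) / 2 = -s by ring,
    show 2 * s / 2 = s by ring, mul_comm _ (Complex.Gamma s), mul_assoc,
    ← tsum_mul_left (a := (Real.pi : ℂ) ^ (-s))]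
  congr 1
  refine tsum_congr fun n => ?_
  have e : (((n : ℂ) + 1) ^ (2 : ℕ)) ^ s = ((n : ℂ) + 1) ^ (2 * s) := by
    have := Complex.natCast_cpow_natCast_mul (n + 1) 2 s
    push_cast at this
    exact this.symm
  rw [one_div, ← e, Complex.cpow_neg, Complex.cpow_neg, ← mul_inv, thetaExponent,
    Complex.ofReal_mul, Complex.mul_cpow_ofReal_nonneg Real.pi_pos.le (by positivity)]
  push_cast
  rfl

lemma mellin_xiKernel_of_one_lt_re {s : ℂ} (hs : 1 < s.re) :
    mellin (fun x => (xiKernel x : ℂ)) s = s * (2 * s - 1) * completedRiemannZeta (2 * s) := by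
  have hs0 : s ≠ 0 := by rintro rfl; simp at hs; linarith
  have hs1 : s + 1 ≠ 0 := by
    intro h; have := congrArg Complex.re h; simp at this; linarith
  have hc2 := mellinConvergent_thetaTail 2 (s := s + (2 : ℕ)) (by simp; linarith)
  have hc1 := mellinConvergent_thetaTail 1 (s := s + (1 : ℕ)) (by simp; linarith)
  have h := (hasMellin_add ((MellinConvergent.cpow_smul.mpr hc2).const_smul (2 : ℂ))
    ((MellinConvergent.cpow_smul.mpr hc1).const_smul (3 : ℂ))).2
  rw [mellin_const_smul, mellin_const_smul, mellin_cpow_smul, mellin_cpow_smul,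
    mellin_thetaTail 2 hs, mellin_thetaTail 1 hs] at h
  have hG2 : Complex.Gamma (s + (2 : ℕ)) = (s + 1) * (s * Complex.Gamma s) := by
    rw [← Complex.Gamma_add_one _ hs0, ← Complex.Gamma_add_one _ hs1]
    congr 1; push_cast; ring
  rw [← tsum_thetaExponent_cpow hs]
  have hK : (fun x => (xiKernel x : ℂ)) = fun t : ℝ =>
      (2 : ℂ) • ((t : ℂ) ^ ((2 : ℕ) : ℂ) • (thetaTail 2 t : ℂ)) +
        (3 : ℂ) • ((t : ℂ) ^ ((1 : ℕ) : ℂ) • (thetaTail 1 t : ℂ)) := by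
    ext x
    simp only [xiKernel, smul_eq_mul, Complex.cpow_natCast]
    push_cast
    ring
  rw [hK, h, hG2, Nat.cast_one, Complex.Gamma_add_one _ hs0]
  simp only [smul_eq_mul]
  ring

/-- Riemann's `ξ(2 s)` is the Mellin transform of `xiKernel` at every point of the plane. -/
lemma mellin_xiKernel (s : ℂ) :
    mellin (fun x => (xiKernel x : ℂ)) s =
      (2 * s * (2 * s - 1) * completedRiemannZeta₀ (2 * s) + 1) / 2 := by
  have hd : Differentiable ℂ fun s : ℂ =>
      (2 * s * (2 * s - 1) * completedRiemannZeta₀ (2 * s) + 1) / 2 := by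
    have := differentiable_completedZeta₀
    fun_prop
  refine congrFun (AnalyticOnNhd.eq_of_eventuallyEq (z₀ := 2)
    (fun w _ => differentiable_mellin_xiKernel.analyticAt w) (fun w _ => hd.analyticAt w) ?_) s
  have ho : ∀ᶠ w : ℂ in 𝓝 2, 1 < w.re :=
    (isOpen_lt continuous_const Complex.continuous_re).mem_nhds (by simp)
  filter_upwards [ho] with w hw
  have hw0 : w ≠ 0 := by rintro rfl; simp at hw; linarith
  have hw1 : 1 - 2 * w ≠ 0 := by
    intro h; have := congrArg Complex.re h; simp at this; linarith
  rw [mellin_xiKernel_of_one_lt_re hw, completedRiemannZeta_eq]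
  -- Multiplied by `2w (2w - 1)`, the polar terms `-1/(2w) - 1/(1 - 2w)` of `Λ(2w)` become the
  -- constant `1`.
  have e1 : 2 * w * (1 / (2 * w)) = 1 := mul_one_div_cancel (mul_ne_zero two_ne_zero hw0)
  have e2 : (1 - 2 * w) * (1 / (1 - 2 * w)) = 1 := mul_one_div_cancel hw1
  linear_combination (1 / 2 - w) * e1 + w * e2

lemma riemannXi_eq_mellin (z : ℂ) :
    riemannXi z = mellin (fun x => (xiKernel x : ℂ)) ((1 + 2 * Complex.I * z) / 4) := by
  rw [(riemannXi_eq z).2, mellin_xiKernel]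
  ring_nf

/-- The positive function `2 e^{-t/2} ∑ (2 π² n⁴ e^{-4t} - 3 π n² e^{-2t}) exp (-π n² e^{-2t})`
whose Fourier transform is the Riemann Xi function. -/
noncomputable def xiDensity (t : ℝ) : ℝ :=
  2 * Real.exp (-t / 2) * xiKernel (Real.exp (-2 * t))

lemma xiDensity_pos (t : ℝ) : 0 < xiDensity t := by
  have := xiKernel_pos (Real.exp_pos (-2 * t))
  unfold xiDensity
  positivity

lemma riemannXi_fourier (z : ℂ) :
    Integrable (fun t : ℝ => Complex.exp (-Complex.I * t * z) * (xiDensity t : ℂ)) ∧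
    riemannXi z = ∫ t : ℝ, Complex.exp (-Complex.I * t * z) * (xiDensity t : ℂ) := by
  have himg : (fun t : ℝ => Real.exp (-2 * t)) '' univ = Ioi 0 := by
    ext x
    simp only [image_univ, mem_range, mem_Ioi]
    refine ⟨?_, fun hx => ⟨-Real.log x / 2, ?_⟩⟩
    · rintro ⟨t, rfl⟩; exact Real.exp_pos _
    · rw [show -2 * (-Real.log x / 2) = Real.log x by ring, Real.exp_log hx]
  have hinj : InjOn (fun t : ℝ => Real.exp (-2 * t)) univ := by
    intro a _ b _ h
    have := Real.exp_injective h
    linarith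
  have hder : ∀ t ∈ (univ : Set ℝ), HasDerivWithinAt (fun t : ℝ => Real.exp (-2 * t))
      (-2 * Real.exp (-2 * t)) univ t := fun t _ => by
    have h := ((hasDerivAt_id t).const_mul (-2)).exp.hasDerivWithinAt (s := univ)
    exact h.congr_deriv (by simp only [id, mul_one]; ring)
  have hval (t : ℝ) : |-2 * Real.exp (-2 * t)| •
      (((Real.exp (-2 * t) : ℝ) : ℂ) ^ ((1 + 2 * Complex.I * z) / 4 - 1) •
        (xiKernel (Real.exp (-2 * t)) : ℂ)) =
      Complex.exp (-Complex.I * t * z) * (xiDensity t : ℂ) := by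
    have habs : |-2 * Real.exp (-2 * t)| = 2 * Real.exp (-2 * t) := by
      rw [abs_mul, abs_of_pos (Real.exp_pos _)]; norm_num
    have hpow : ((Real.exp (-2 * t) : ℝ) : ℂ) ^ ((1 + 2 * Complex.I * z) / 4 - 1) =
        Complex.exp (-2 * t * ((1 + 2 * Complex.I * z) / 4 - 1)) := by
      rw [Complex.cpow_def_of_ne_zero (by exact_mod_cast (Real.exp_pos _).ne'),
        ← Complex.ofReal_log (Real.exp_pos _).le, Real.log_exp]
      push_cast; rfl
    rw [habs, hpow, xiDensity, Complex.real_smul, smul_eq_mul]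
    push_cast
    -- The summands come from the Jacobian, the Mellin power and the factor `e^(-t/2)` of
    -- `xiDensity`.
    rw [show -Complex.I * t * z = -2 * t + -2 * t * ((1 + 2 * Complex.I * z) / 4 - 1) - -t / 2 by
      ring, Complex.exp_sub, Complex.exp_add]
    field_simp
  have hconv := mellinConvergent_xiKernel ((1 + 2 * Complex.I * z) / 4)
  rw [MellinConvergent, ← himg, integrableOn_image_iff_integrableOn_abs_deriv_smul
    MeasurableSet.univ hder hinj, integrableOn_univ] at hconv
  refine ⟨hconv.congr (.of_forall hval), ?_⟩
  rw [riemannXi_eq_mellin, mellin, ← himg, integral_image_eq_integral_abs_deriv_smul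
    MeasurableSet.univ hder hinj, setIntegral_univ]
  exact integral_congr_ae (.of_forall hval)

end XiMellin

/-! ### Positive semidefiniteness of Fourier kernels and of entrywise products. -/

section PosSemidef

open MeasureTheory

/-- A kernel given by the Fourier–Laplace transform of a nonnegative density gives positive
semidefinite matrices at the points `z j - conj (z k)`. -/
lemma posSemidef_of_fourier {ι : Type*} [Finite ι] {F : ℂ → ℂ} {φ : ℝ → ℝ} (hφ : ∀ t, 0 ≤ φ t)
    (hF : ∀ z : ℂ, Integrable (fun t : ℝ => Complex.exp (-Complex.I * t * z) * (φ t : ℂ)) ∧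
      F z = ∫ t : ℝ, Complex.exp (-Complex.I * t * z) * (φ t : ℂ)) (z : ι → ℂ) :
    (Matrix.of fun j k => F (z j - (starRingEnd ℂ) (z k))).PosSemidef := by
  have := Fintype.ofFinite ι
  have hexp (t : ℝ) (a : ℂ) : (starRingEnd ℂ) (Complex.exp (-Complex.I * t * a)) =
      Complex.exp (Complex.I * t * (starRingEnd ℂ) a) := by
    rw [← Complex.exp_conj]; simp
  refine .of_dotProduct_mulVec_nonneg ?_ fun c => ?_
  · ext j k
    simp only [Matrix.conjTranspose_apply, Matrix.of_apply, (hF _).2, Complex.star_def,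
      ← integral_conj]
    refine integral_congr_ae (.of_forall fun t => ?_)
    simp only [map_mul, hexp, Complex.conj_ofReal, map_sub, Complex.conj_conj]
    congr 2
    ring
  -- The quadratic form is the integral of `φ` times a squared modulus.
  · have key : star c ⬝ᵥ ((Matrix.of fun j k => F (z j - (starRingEnd ℂ) (z k))).mulVec c) =
        ∫ t : ℝ, ((‖∑ j, (starRingEnd ℂ) (c j) * Complex.exp (-Complex.I * t * z j)‖ ^ 2 * φ t :
          ℝ) : ℂ) := by
      have hint (j k : ι) : Integrable fun t : ℝ => (starRingEnd ℂ) (c j) *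
          (Complex.exp (-Complex.I * t * (z j - (starRingEnd ℂ) (z k))) * (φ t : ℂ) * c k) :=
        ((hF _).1.mul_const _).const_mul _
      have hpt (t : ℝ) : ((‖∑ j, (starRingEnd ℂ) (c j) * Complex.exp (-Complex.I * t * z j)‖ ^ 2 *
          φ t : ℝ) : ℂ) = ∑ j, ∑ k, (starRingEnd ℂ) (c j) *
          (Complex.exp (-Complex.I * t * (z j - (starRingEnd ℂ) (z k))) * (φ t : ℂ) * c k) := by
        rw [Complex.ofReal_mul, Complex.ofReal_pow, ← Complex.mul_conj', map_sum,
          Finset.sum_mul_sum, Finset.sum_mul]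
        refine Finset.sum_congr rfl fun j _ => ?_
        rw [Finset.sum_mul]
        refine Finset.sum_congr rfl fun k _ => ?_
        rw [map_mul, hexp, Complex.conj_conj, show -Complex.I * t * (z j - (starRingEnd ℂ) (z k)) =
          -Complex.I * t * z j + Complex.I * t * (starRingEnd ℂ) (z k) by ring, Complex.exp_add]
        ring
      simp_rw [hpt]
      rw [integral_finsetSum _ fun j _ => integrable_finsetSum _ fun k _ => hint j k]
      simp only [dotProduct, Matrix.mulVec, Matrix.of_apply, Finset.mul_sum, Pi.star_apply,
        Complex.star_def]
      refine Finset.sum_congr rfl fun j _ => ?_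
      rw [integral_finsetSum _ fun k _ => hint j k]
      refine Finset.sum_congr rfl fun k _ => ?_
      rw [integral_const_mul, integral_mul_const, (hF _).2]
    rw [key, integral_complex_ofReal]
    exact_mod_cast integral_nonneg fun t => mul_nonneg (by positivity) (hφ t)

/-- Schur's product theorem, iterated; the empty product is the all-ones matrix, of the form `v v*`.
-/
lemma posSemidef_prod {ι κ : Type*} [Finite ι] (s : Finset κ) (M : κ → Matrix ι ι ℂ)
    (hM : ∀ l ∈ s, (M l).PosSemidef) :
    (Matrix.of fun j k => ∏ l ∈ s, M l j k).PosSemidef := by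
  classical
  have := Fintype.ofFinite ι
  induction s using Finset.induction_on with
  | empty =>
    have h := Matrix.posSemidef_vecMulVec_self_star (fun _ : ι => (1 : ℂ))
    convert h using 1
    ext j k
    simp [Matrix.vecMulVec]
  | insert a s ha ih =>
    have h := (hM a (Finset.mem_insert_self a s)).hadamard
      (ih fun l hl => hM l (Finset.mem_insert_of_mem hl))
    have e : (Matrix.of fun j k => ∏ l ∈ insert a s, M l j k) =
        (M a).hadamard (Matrix.of fun j k => ∏ l ∈ s, M l j k) := by
      ext j k
      simp [Finset.prod_insert ha]
    rw [e]
    exact h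

end PosSemidef

theorem mainTheorem5 :
    (∃ φ : ℝ → ℝ, (∀ t, 0 < φ t) ∧ ∀ z : ℂ,
      MeasureTheory.Integrable (fun t : ℝ => Complex.exp (-Complex.I * t * z) * (φ t : ℂ)) ∧
      riemannXi z = ∫ t : ℝ, Complex.exp (-Complex.I * t * z) * (φ t : ℂ)) ∧
    ∀ (n m : ℕ) (z : Fin n → Fin m → ℂ),
      (Matrix.of fun j k : Fin n =>
        ∏ l : Fin m, riemannXi (z j l - (starRingEnd ℂ) (z k l))).PosSemidef :=
  ⟨⟨xiDensity, xiDensity_pos, riemannXi_fourier⟩, fun _ _ z =>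
    posSemidef_prod Finset.univ
      (fun l => Matrix.of fun j k => riemannXi (z j l - (starRingEnd ℂ) (z k l)))
      fun l _ => posSemidef_of_fourier (fun t => (xiDensity_pos t).le) riemannXi_fourier
        fun j => z j l⟩
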